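/- For complex $x,q$ with $0<|q|<1$ and an integer $n\ge 0$ let $(x;q)_\infty=\prod_{k\ge 0}(1-xq^k)$, $(x;q)_n=\prod_{k=0}^{n-1}(1-xq^k)$ and $(a,b,c;q)_\infty=(a;q)_\infty(b;q)_\infty(c;q)_\infty$. Then for every complex $q$ with $0<|q|<1$ the following series converges absolutely and \begin{align*} \sum_{n=0}^{\infty}(\mp 1)^n\frac{(\pm q;q^2)_n}{(q^2;q^2)_{2n}}\,(q^{2n}-1)\,q^{3n^2-2n} =\frac{(\pm q;q^2)_\infty}{(q^2;q^2)_\infty}\Big(&(\pm q^{13},\pm q^{17},q^{30};q^{30})_\infty-(\pm q^{11},\pm q^{19},q^{30};q^{30})_\infty\\ &\pm q\,(\pm q^{7},\pm q^{23},q^{30};q^{30})_\infty\mp q^3\,(\pm q,\pm q^{29},q^{30};q^{30})_\infty\Big), \end{align*} where either all upper signs or all lower signs are taken (two identities). -/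

import Mathlib

/-- The infinite `q`-shifted factorial `(x; q)_∞ = ∏_{k ≥ 0} (1 - x q^k)`. -/
noncomputable def qPochInf (x q : ℂ) : ℂ :=
  ∏' k : ℕ, (1 - x * q ^ k)

/-- The finite `q`-shifted factorial `(x; q)_n = ∏_{0 ≤ k < n} (1 - x q^k)`. -/
noncomputable def qPoch (x q : ℂ) (n : ℕ) : ℂ :=
  ∏ k ∈ Finset.range n, (1 - x * q ^ k)

/-- The compact notation `(a, b, c; q)_∞ = (a; q)_∞ (b; q)_∞ (c; q)_∞`. -/
noncomputable def qPochInf₃ (a b c q : ℂ) : ℂ :=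
  qPochInf a q * qPochInf b q * qPochInf c q

/-- The infinite product defining `(x; q)_∞` converges when `|q| < 1`. -/
theorem qPochInf_multipliable (x q : ℂ) (hq : ‖q‖ < 1) :
    Multipliable fun k : ℕ => 1 - x * q ^ k := by
  have h : Summable fun k : ℕ => ‖-(x * q ^ k)‖ := by
    simp only [norm_neg, norm_mul, norm_pow]
    exact (summable_geometric_of_lt_one (norm_nonneg q) hq).mul_left _
  simpa [sub_eq_add_neg] using multipliable_one_add_of_summable h

/-- The finite factorial is the quotient `(x; q)_∞ / (x q^n; q)_∞` whenever the latter makes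
sense. -/
theorem qPoch_eq_div (x q : ℂ) (hq : ‖q‖ < 1) (n : ℕ) (h0 : qPochInf (x * q ^ n) q ≠ 0) :
    qPoch x q n = qPochInf x q / qPochInf (x * q ^ n) q := by
  rw [eq_div_iff h0]
  unfold qPoch qPochInf
  have h := qPochInf_multipliable (x * q ^ n) q hq
  have e : ∀ k : ℕ, 1 - x * q ^ n * q ^ k = 1 - x * q ^ (k + n) := fun k => by ring
  simp only [e] at h ⊢
  exact Multipliable.prod_mul_tprod_nat_mul' (f := fun k : ℕ => 1 - x * q ^ k) (k := n) h

open Filter Topology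

/-! ### `q`-factorials -/

/-! Replacing `q` by `εq` turns the upper-sign identity into either one, so take `ε = 1`. The factor
`q^(2n) - 1` splits the series into a difference of two, `∑ (-1)^n (q;q²)_n q^(n²) β_n`, with `β_n =
q^(2n²)/(q²;q²)_{2n}` and `β_n = q^(2n²-2n)/(q²;q²)_{2n}`.

Each `β_n` is expanded, in base `q²`, as `∑_j α_j / ((q²;q²)_{n-j} (q²;q²)_{n+j})`, where `α` lives
on two residue classes mod 3 and is, up to sign, a power of `q` with quadratic exponent
(`bailey_pair_sq`, `bailey_pair_sq_sub`). Summing over `n` first, a limiting Bailey lemma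
(`tsum_baileyTerm`) replaces the kernel of `j` by `(q;q²)_∞/(q²;q²)_∞ · (-1)^j q^(j²)`. What
remains, for each residue class, is a theta series with leading exponent `15k²`, which the Jacobi
triple product turns into a product of modulus 30: two pairs with two classes each give the four
products.

The Bailey pairs and the finite triple product both come from the two `q`-Pascal rules for bilateral
sums. -/

theorem qPoch_zero (x q : ℂ) : qPoch x q 0 = 1 := by simp [qPoch]

theorem qPoch_succ (x q : ℂ) (n : ℕ) :
    qPoch x q (n + 1) = qPoch x q n * (1 - x * q ^ n) := by
  simp [qPoch, Finset.prod_range_succ]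

theorem tendsto_qPoch (x : ℂ) {q : ℂ} (hq : ‖q‖ < 1) :
    Tendsto (qPoch x q) atTop (𝓝 (qPochInf x q)) :=
  (qPochInf_multipliable x q hq).tendsto_prod_tprod_nat

theorem pow_succ_ne_one_of_norm_lt_one {q : ℂ} (hq : ‖q‖ < 1) (n : ℕ) : q ^ (n + 1) ≠ 1 := by
  intro h
  have h1 : ‖q‖ ^ (n + 1) < 1 := pow_lt_one₀ (norm_nonneg q) hq n.succ_ne_zero
  rw [← norm_pow, h, norm_one] at h1
  exact lt_irrefl _ h1

theorem qPoch_self_ne_zero {q : ℂ} (hq : ‖q‖ < 1) (n : ℕ) : qPoch q q n ≠ 0 := by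
  refine Finset.prod_ne_zero_iff.2 fun k _ h => pow_succ_ne_one_of_norm_lt_one hq k ?_
  rw [pow_succ']
  exact (sub_eq_zero.1 h).symm

theorem qPochInf_self_ne_zero {q : ℂ} (hq : ‖q‖ < 1) : qPochInf q q ≠ 0 := by
  have h := tprod_one_add_ne_zero_of_summable (f := fun k : ℕ => -(q * q ^ k)) ?_ ?_
  · simpa [qPochInf, sub_eq_add_neg] using h
  · intro k hk
    refine pow_succ_ne_one_of_norm_lt_one hq k ?_
    rw [pow_succ']
    linear_combination -hk
  · simp only [norm_neg, norm_mul, norm_pow]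
    exact (summable_geometric_of_lt_one (norm_nonneg q) hq).mul_left _

theorem exists_norm_qPoch_le (x : ℂ) {q : ℂ} (hq : ‖q‖ < 1) :
    ∃ C, 0 ≤ C ∧ ∀ n, ‖qPoch x q n‖ ≤ C := by
  obtain ⟨C, hC⟩ := (Metric.isBounded_range_of_tendsto _ (tendsto_qPoch x hq)).exists_norm_le
  exact ⟨C, (norm_nonneg _).trans (hC _ ⟨0, rfl⟩), fun n => hC _ ⟨n, rfl⟩⟩

/-- The reciprocal `1 / (q; q)_j` of the `q`-factorial, extended by zero to negative `j`. -/
noncomputable def qFactInv (q : ℂ) (j : ℤ) : ℂ :=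
  if 0 ≤ j then (qPoch q q j.toNat)⁻¹ else 0

theorem qFactInv_natCast (q : ℂ) (n : ℕ) : qFactInv q n = (qPoch q q n)⁻¹ := by
  simp [qFactInv]

theorem qFactInv_zero (q : ℂ) : qFactInv q 0 = 1 := by
  simp [qFactInv, qPoch_zero]

theorem qFactInv_of_neg (q : ℂ) {j : ℤ} (hj : j < 0) : qFactInv q j = 0 := by
  simp [qFactInv, not_le.2 hj]

/-- Extension by zero is compatible with the recursion: at `j = 0` the factor `1 - q^0` vanishes.
Hence the Pascal rules below need no boundary cases. -/
theorem one_sub_zpow_mul_qFactInv {q : ℂ} (hq : ‖q‖ < 1) (j : ℤ) :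
    (1 - q ^ j) * qFactInv q j = qFactInv q (j - 1) := by
  rcases lt_trichotomy j 0 with hj | rfl | hj
  · rw [qFactInv_of_neg q hj, qFactInv_of_neg q (by lia), mul_zero]
  · rw [qFactInv_of_neg q (j := 0 - 1) (by lia), zpow_zero, sub_self, zero_mul]
  · obtain ⟨n, rfl⟩ : ∃ n : ℕ, j = (n + 1 : ℕ) := ⟨(j - 1).toNat, by lia⟩
    rw [zpow_natCast, qFactInv_natCast, qPoch_succ]
    push_cast
    rw [add_sub_cancel_right, qFactInv_natCast, ← pow_succ']
    have h := pow_succ_ne_one_of_norm_lt_one hq n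
    have h1 : 1 - q ^ (n + 1) ≠ 0 := sub_ne_zero.2 h.symm
    have h2 := qPoch_self_ne_zero hq n
    field_simp

theorem tendsto_qFactInv {q : ℂ} (hq : ‖q‖ < 1) :
    Tendsto (qFactInv q) atTop (𝓝 (qPochInf q q)⁻¹) := by
  have h : Tendsto (fun j : ℤ => (qPoch q q j.toNat)⁻¹) atTop (𝓝 (qPochInf q q)⁻¹) :=
    ((tendsto_qPoch q hq).comp
      (tendsto_atTop.2 fun n => (eventually_ge_atTop (n : ℤ)).mono fun j hj => by lia)).inv₀
      (qPochInf_self_ne_zero hq)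
  refine h.congr' ((eventually_ge_atTop 0).mono fun j hj => ?_)
  simp [qFactInv, hj]

theorem exists_norm_qFactInv_le {q : ℂ} (hq : ‖q‖ < 1) :
    ∃ C, 0 ≤ C ∧ ∀ j, ‖qFactInv q j‖ ≤ C := by
  obtain ⟨C, hC⟩ := (Metric.isBounded_range_of_tendsto _
    ((tendsto_qPoch q hq).inv₀ (qPochInf_self_ne_zero hq))).exists_norm_le
  have hC0 : 0 ≤ C := (norm_nonneg _).trans (hC _ ⟨0, rfl⟩)
  refine ⟨C, hC0, fun j => ?_⟩
  rcases lt_or_ge j 0 with hj | hj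
  · simpa [qFactInv_of_neg q hj] using hC0
  · simpa [qFactInv, hj] using hC _ ⟨j.toNat, rfl⟩

/-! ### Bilateral sums of products of reciprocal `q`-factorials -/

/-- The terminating sum `∑ₖ c(k) / ((q; q)_{a - mk} (q; q)_{b + mk})`. -/
noncomputable def binomSum (q : ℂ) (m : ℤ) (c : ℤ → ℂ) (a b : ℤ) : ℂ :=
  ∑' k : ℤ, c k * (qFactInv q (a - m * k) * qFactInv q (b + m * k))

/-- Outside `-|b| ≤ k ≤ |a|` one of the two indices is negative, so the support is finite. -/
theorem summable_binomSum (q : ℂ) {m : ℤ} (hm : 0 < m) (c : ℤ → ℂ) (a b : ℤ) :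
    Summable fun k : ℤ => c k * (qFactInv q (a - m * k) * qFactInv q (b + m * k)) := by
  refine summable_of_hasFiniteSupport ((Set.finite_Icc (-|b|) |a|).subset fun k hk => ?_)
  by_contra hk'
  refine hk ?_
  beta_reduce
  rw [Set.mem_Icc, not_and_or, not_le, not_le] at hk'
  rcases hk' with h | h
  · rw [qFactInv_of_neg q (j := b + m * k), mul_zero, mul_zero]
    nlinarith [le_abs_self b, abs_nonneg b]
  · rw [qFactInv_of_neg q (j := a - m * k), zero_mul, mul_zero]
    nlinarith [le_abs_self a, abs_nonneg a]

theorem binomSum_shift (q : ℂ) (m : ℤ) (c : ℤ → ℂ) (a b : ℤ) :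
    binomSum q m c a b = binomSum q m (fun k => c (k + 1)) (a - m) (b + m) := by
  unfold binomSum
  rw [← (Equiv.addRight (1 : ℤ)).tsum_eq]
  refine tsum_congr fun k => ?_
  simp only [Equiv.coe_addRight]
  congr 3 <;> ring

theorem binomSum_const_mul (q : ℂ) (m : ℤ) (d : ℂ) (c : ℤ → ℂ) (a b : ℤ) :
    binomSum q m (fun k => d * c k) a b = d * binomSum q m c a b := by
  simp only [binomSum, mul_assoc, tsum_mul_left]

/-- The first `q`-Pascal rule, summed. -/
theorem binomSum_pascal_left {q : ℂ} (hq0 : q ≠ 0) (hq : ‖q‖ < 1) {m : ℤ} (hm : 0 < m)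
    (c : ℤ → ℂ) (a b : ℤ) :
    (1 - q ^ (a + b)) * binomSum q m c a b =
      binomSum q m c (a - 1) b +
        q ^ a * binomSum q m (fun k => c k * q ^ (-(m * k))) a (b - 1) := by
  rw [← binomSum_const_mul q m (1 - q ^ (a + b)), ← binomSum_const_mul q m (q ^ a)]
  unfold binomSum
  rw [← Summable.tsum_add (summable_binomSum q hm c (a - 1) b) (summable_binomSum q hm _ a (b - 1))]
  -- Termwise this is `1 - XY = (1 - X) + X(1 - Y)` with `X = q^(a - mk)`, `Y = q^(b + mk)`; the
  -- second rule exchanges `X` and `Y`.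
  refine tsum_congr fun k => ?_
  rw [show a - 1 - m * k = a - m * k - 1 by ring, show b - 1 + m * k = b + m * k - 1 by ring,
    ← one_sub_zpow_mul_qFactInv hq (a - m * k), ← one_sub_zpow_mul_qFactInv hq (b + m * k),
    show a + b = (a - m * k) + (b + m * k) by ring, zpow_add₀ hq0,
    show q ^ a * (c k * q ^ (-(m * k))) = c k * q ^ (a - m * k) by
      rw [sub_eq_add_neg, zpow_add₀ hq0]; ring]
  ring

/-- The second `q`-Pascal rule, summed. -/
theorem binomSum_pascal_right {q : ℂ} (hq0 : q ≠ 0) (hq : ‖q‖ < 1) {m : ℤ} (hm : 0 < m)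
    (c : ℤ → ℂ) (a b : ℤ) :
    (1 - q ^ (a + b)) * binomSum q m c a b =
      binomSum q m c a (b - 1) +
        q ^ b * binomSum q m (fun k => c k * q ^ (m * k)) (a - 1) b := by
  rw [← binomSum_const_mul q m (1 - q ^ (a + b)), ← binomSum_const_mul q m (q ^ b)]
  unfold binomSum
  rw [← Summable.tsum_add (summable_binomSum q hm c a (b - 1)) (summable_binomSum q hm _ (a - 1) b)]
  refine tsum_congr fun k => ?_
  rw [show a - 1 - m * k = a - m * k - 1 by ring, show b - 1 + m * k = b + m * k - 1 by ring,
    ← one_sub_zpow_mul_qFactInv hq (a - m * k), ← one_sub_zpow_mul_qFactInv hq (b + m * k),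
    show a + b = (a - m * k) + (b + m * k) by ring, zpow_add₀ hq0,
    show q ^ b * (c k * q ^ (m * k)) = c k * q ^ (b + m * k) by
      rw [zpow_add₀ hq0]; ring]
  ring

/-! ### Two Bailey pairs -/

/-- Opposite Pascal rules applied to the two sums both produce the sum at `(n - 1, n)`, which
cancels. Write `E_n` and `O_n` for the differences on the left and right, with index total `2n` and
`2n - 1`. -/
theorem binomSum_even_to_odd {q : ℂ} (hq0 : q ≠ 0) (hq : ‖q‖ < 1) (n : ℤ) :
    (1 - q ^ (2 * n)) * (binomSum q 3 (fun k => q ^ (3 * k ^ 2 + k)) n n -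
        binomSum q 3 (fun k => q ^ (3 * k ^ 2 + k)) (n - 1) (n + 1)) =
      q ^ n * (binomSum q 3 (fun k => q ^ (3 * k ^ 2 - 2 * k)) n (n - 1) -
        binomSum q 3 (fun k => q ^ (3 * k ^ 2 - 2 * k)) (n + 1) (n - 2)) := by
  have h1 := binomSum_pascal_left hq0 hq three_pos (fun k => q ^ (3 * k ^ 2 + k)) n n
  have h2 := binomSum_pascal_right hq0 hq three_pos (fun k => q ^ (3 * k ^ 2 + k)) (n - 1) (n + 1)
  have h3 := binomSum_shift q 3 (fun k => q ^ (3 * k ^ 2 - 2 * k)) (n + 1) (n - 2)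
  have e1 : (fun k : ℤ => q ^ (3 * k ^ 2 + k) * q ^ (-(3 * k))) =
      fun k => q ^ (3 * k ^ 2 - 2 * k) := by
    funext k
    rw [← zpow_add₀ hq0]
    ring_nf
  have e3 : (fun k : ℤ => q ^ (3 * (k + 1) ^ 2 - 2 * (k + 1))) =
      fun k => q * (q ^ (3 * k ^ 2 + k) * q ^ (3 * k)) := by
    funext k
    rw [← zpow_add₀ hq0, ← zpow_one_add₀ hq0]
    ring_nf
  rw [e1, show n + n = 2 * n by ring] at h1
  rw [show n - 1 + (n + 1) = 2 * n by ring, zpow_add_one₀ hq0,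
    show n - 1 - 1 = n + 1 - 3 by ring, show n + 1 - 1 = n by ring,
    show n + 1 = n - 2 + 3 by ring] at h2
  rw [e3, binomSum_const_mul] at h3
  rw [h3, mul_sub, h1, show n + 1 = n - 2 + 3 by ring, h2]
  ring

/-- Here the common sum at `(n, n - 2)` cancels. Together with the preceding step, `E_n = q^(2n-1)
E_{n-1} / ((1 - q^(2n)) (1 - q^(2n-1)))`, a recursion that yields `q^(n²)/(q;q)_{2n}`. -/
theorem binomSum_odd_to_even {q : ℂ} (hq0 : q ≠ 0) (hq : ‖q‖ < 1) (n : ℤ) :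
    (1 - q ^ (2 * n - 1)) * (binomSum q 3 (fun k => q ^ (3 * k ^ 2 - 2 * k)) n (n - 1) -
        binomSum q 3 (fun k => q ^ (3 * k ^ 2 - 2 * k)) (n + 1) (n - 2)) =
      q ^ (n - 1) * (binomSum q 3 (fun k => q ^ (3 * k ^ 2 + k)) (n - 1) (n - 1) -
        binomSum q 3 (fun k => q ^ (3 * k ^ 2 + k)) (n - 1 - 1) (n - 1 + 1)) := by
  have h1 := binomSum_pascal_right hq0 hq three_pos (fun k => q ^ (3 * k ^ 2 - 2 * k)) n (n - 1)
  have h2 := binomSum_pascal_left hq0 hq three_pos (fun k => q ^ (3 * k ^ 2 - 2 * k)) (n + 1) (n - 2)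
  have e1 : (fun k : ℤ => q ^ (3 * k ^ 2 - 2 * k) * q ^ (3 * k)) =
      fun k => q ^ (3 * k ^ 2 + k) := by
    funext k
    rw [← zpow_add₀ hq0]
    ring_nf
  have e2 : (fun k : ℤ => q ^ (3 * (k + 1) ^ 2 - 2 * (k + 1)) * q ^ (-(3 * (k + 1)))) =
      fun k => q ^ (-2 : ℤ) * q ^ (3 * k ^ 2 + k) := by
    funext k
    rw [← zpow_add₀ hq0, ← zpow_add₀ hq0]
    ring_nf
  rw [e1, show n + (n - 1) = 2 * n - 1 by ring, show n - 1 - 1 = n - 2 by ring] at h1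
  rw [binomSum_shift q 3 (fun k => q ^ (3 * k ^ 2 - 2 * k) * q ^ (-(3 * k))), e2,
    binomSum_const_mul, show n + 1 + (n - 2) = 2 * n - 1 by ring, ← mul_assoc, ← zpow_add₀ hq0,
    show n + 1 + -2 = n - 1 by ring, show n + 1 - 1 = n by ring,
    show n + 1 - 3 = n - 1 - 1 by ring, show n - 2 - 1 + 3 = n - 1 + 1 by ring] at h2
  rw [mul_sub, h1, h2]
  ring

/-- The same `O_n` is reached without the factor `q^n`; now the parts carrying a power of `q`
cancel. So this second difference is `q^(-n) E_n` for `n ≥ 1`, and needs no induction of its own. -/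
theorem binomSum_even_to_odd' {q : ℂ} (hq0 : q ≠ 0) (hq : ‖q‖ < 1) (n : ℤ) :
    (1 - q ^ (2 * n)) * (binomSum q 3 (fun k => q ^ (3 * k ^ 2 - 2 * k)) n n -
        binomSum q 3 (fun k => q ^ (3 * k ^ 2 - 2 * k)) (n + 2) (n - 2)) =
      binomSum q 3 (fun k => q ^ (3 * k ^ 2 - 2 * k)) n (n - 1) -
        binomSum q 3 (fun k => q ^ (3 * k ^ 2 - 2 * k)) (n + 1) (n - 2) := by
  have h1 := binomSum_pascal_right hq0 hq three_pos (fun k => q ^ (3 * k ^ 2 - 2 * k)) n n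
  have h2 := binomSum_pascal_left hq0 hq three_pos (fun k => q ^ (3 * k ^ 2 - 2 * k)) (n + 2) (n - 2)
  have e1 : (fun k : ℤ => q ^ (3 * k ^ 2 - 2 * k) * q ^ (3 * k)) =
      fun k => q ^ (3 * k ^ 2 + k) := by
    funext k
    rw [← zpow_add₀ hq0]
    ring_nf
  have e2 : (fun k : ℤ => q ^ (3 * (k + 1) ^ 2 - 2 * (k + 1)) * q ^ (-(3 * (k + 1)))) =
      fun k => q ^ (-2 : ℤ) * q ^ (3 * k ^ 2 + k) := by
    funext k
    rw [← zpow_add₀ hq0, ← zpow_add₀ hq0]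
    ring_nf
  rw [e1, show n + n = 2 * n by ring] at h1
  rw [binomSum_shift q 3 (fun k => q ^ (3 * k ^ 2 - 2 * k) * q ^ (-(3 * k))), e2,
    binomSum_const_mul, show n + 2 + (n - 2) = 2 * n by ring, ← mul_assoc, ← zpow_add₀ hq0,
    show n + 2 + -2 = n by ring, show n + 2 - 1 = n + 1 by ring,
    show n + 2 - 3 = n - 1 by ring, show n - 2 - 1 + 3 = n by ring] at h2
  rw [mul_sub, h1, h2]
  ring

theorem binomSum_three_zero_zero (q : ℂ) (c : ℤ → ℂ) : binomSum q 3 c 0 0 = c 0 := by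
  unfold binomSum
  rw [tsum_eq_single 0]
  · simp [qFactInv_zero]
  · intro k hk
    rcases lt_or_gt_of_ne hk with h | h
    · rw [qFactInv_of_neg q (j := 0 + 3 * k) (by lia), mul_zero, mul_zero]
    · rw [qFactInv_of_neg q (j := 0 - 3 * k) (by lia), zero_mul, mul_zero]

/-- The two indices are opposite integers, so neither is negative only when `3k = a`. -/
theorem binomSum_three_eq_zero (q : ℂ) (c : ℤ → ℂ) {a : ℤ} (ha : ¬ 3 ∣ a) :
    binomSum q 3 c a (-a) = 0 := by
  unfold binomSum
  rw [← tsum_zero (α := ℂ) (β := ℤ)]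
  refine tsum_congr fun k => ?_
  rcases lt_or_ge a (3 * k) with h | h
  · rw [qFactInv_of_neg q (j := a - 3 * k) (by lia), zero_mul, mul_zero]
  · rw [qFactInv_of_neg q (j := -a + 3 * k) (by lia), mul_zero, mul_zero]

/-- The Bailey pair with `β n = q ^ n² / (q; q)_{2n}`. -/
theorem bailey_pair_sq {q : ℂ} (hq0 : q ≠ 0) (hq : ‖q‖ < 1) (n : ℕ) :
    binomSum q 3 (fun k => q ^ (3 * k ^ 2 + k)) n n -
        binomSum q 3 (fun k => q ^ (3 * k ^ 2 + k)) (n - 1) (n + 1) =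
      q ^ (n ^ 2) * qFactInv q (2 * n) := by
  induction n with
  | zero =>
    have h := binomSum_three_eq_zero q (fun k => q ^ (3 * k ^ 2 + k)) (a := -1) (by lia)
    simp only [neg_neg] at h
    simp [binomSum_three_zero_zero, h, qFactInv_zero]
  | succ n ih =>
    have h1 := binomSum_even_to_odd hq0 hq (n + 1)
    have h2 := binomSum_odd_to_even hq0 hq (n + 1)
    have p1 := one_sub_zpow_mul_qFactInv hq (2 * (n + 1))
    have p2 := one_sub_zpow_mul_qFactInv hq (2 * (n + 1) - 1)
    rw [add_sub_cancel_right (n : ℤ) 1, ih] at h2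
    rw [show 2 * ((n : ℤ) + 1) - 1 - 1 = 2 * n by ring] at p2
    have n1 : (1 - q ^ (2 * ((n : ℤ) + 1))) ≠ 0 := by
      have := pow_succ_ne_one_of_norm_lt_one hq (2 * n + 1)
      rw [← zpow_natCast] at this
      push_cast at this
      exact sub_ne_zero.2 fun h => this (by rw [h]; ring_nf)
    have n2 : (1 - q ^ (2 * ((n : ℤ) + 1) - 1)) ≠ 0 := by
      have := pow_succ_ne_one_of_norm_lt_one hq (2 * n)
      rw [← zpow_natCast] at this
      push_cast at this
      exact sub_ne_zero.2 fun h => this (by rw [h]; ring_nf)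
    push_cast
    refine mul_left_cancel₀ n1 (mul_left_cancel₀ n2 ?_)
    rw [h1, add_sub_cancel_right (n : ℤ) 1, mul_left_comm, h2, mul_left_comm _ (q ^ (n + 1) ^ 2),
      p1, mul_left_comm _ (q ^ (n + 1) ^ 2),
      p2, zpow_natCast, zpow_add_one₀ hq0, zpow_natCast]
    ring

/-- The Bailey pair with `β n = q ^ (n² - n) / (q; q)_{2n}`. -/
theorem bailey_pair_sq_sub {q : ℂ} (hq0 : q ≠ 0) (hq : ‖q‖ < 1) (n : ℕ) :
    binomSum q 3 (fun k => q ^ (3 * k ^ 2 - 2 * k)) n n -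
        binomSum q 3 (fun k => q ^ (3 * k ^ 2 - 2 * k)) (n + 2) (n - 2) =
      q ^ ((n : ℤ) ^ 2 - n) * qFactInv q (2 * n) := by
  rcases n with _ | n
  · have h := binomSum_three_eq_zero q (fun k => q ^ (3 * k ^ 2 - 2 * k)) (a := 2) (by lia)
    simp [binomSum_three_zero_zero, h, qFactInv_zero]
  · have h0 := bailey_pair_sq hq0 hq (n + 1)
    have h1 := binomSum_even_to_odd hq0 hq (n + 1)
    have h2 := binomSum_even_to_odd' hq0 hq (n + 1)
    have n1 : (1 - q ^ (2 * ((n : ℤ) + 1))) ≠ 0 := by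
      have := pow_succ_ne_one_of_norm_lt_one hq (2 * n + 1)
      rw [← zpow_natCast] at this
      push_cast at this
      exact sub_ne_zero.2 fun h => this (by rw [h]; ring_nf)
    push_cast at h0 ⊢
    rw [h0, ← h2, mul_left_comm (q ^ ((n : ℤ) + 1))] at h1
    have h3 := mul_left_cancel₀ n1 h1
    refine mul_left_cancel₀ (zpow_ne_zero ((n : ℤ) + 1) hq0) ?_
    rw [← h3, ← mul_assoc, ← zpow_add₀ hq0, ← zpow_natCast]
    push_cast
    ring_nf

/-! ### The Jacobi triple product -/

theorem summable_pow_mul_pow_sq {y s : ℂ} (hy : y ≠ 0) (hs0 : s ≠ 0) (hs : ‖s‖ < 1) :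
    Summable fun n : ℕ => y ^ n * s ^ (n ^ 2) := by
  refine summable_of_ratio_test_tendsto_lt_one (l := 0) zero_lt_one
    (Eventually.of_forall fun n => mul_ne_zero (pow_ne_zero _ hy) (pow_ne_zero _ hs0)) ?_
  have h : Tendsto (fun n : ℕ => ‖y‖ * ‖s‖ * (‖s‖ ^ 2) ^ n) atTop (𝓝 (‖y‖ * ‖s‖ * 0)) :=
    (tendsto_pow_atTop_nhds_zero_of_lt_one (sq_nonneg _)
      (pow_lt_one₀ (norm_nonneg s) hs two_ne_zero)).const_mul _
  rw [mul_zero] at h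
  refine h.congr fun n => ?_
  have h1 : ‖y‖ ≠ 0 := norm_ne_zero_iff.2 hy
  have h2 : ‖s‖ ≠ 0 := norm_ne_zero_iff.2 hs0
  simp only [norm_mul, norm_pow]
  rw [eq_div_iff (by positivity)]
  ring

theorem summable_zpow_mul_zpow_sq {y s : ℂ} (hy : y ≠ 0) (hs0 : s ≠ 0) (hs : ‖s‖ < 1) :
    Summable fun k : ℤ => y ^ k * s ^ (k ^ 2) := by
  refine Summable.of_nat_of_neg ?_ ?_
  · exact_mod_cast summable_pow_mul_pow_sq hy hs0 hs
  · refine (summable_pow_mul_pow_sq (inv_ne_zero hy) hs0 hs).congr fun n => ?_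
    rw [neg_sq, zpow_neg, zpow_natCast, inv_pow]
    norm_cast

/-- The finite form of the Jacobi triple product. -/
theorem binomSum_triple_product {y s : ℂ} (hy : y ≠ 0) (hs0 : s ≠ 0) (hs : ‖s‖ < 1) (n : ℕ) :
    binomSum (s ^ 2) 1 (fun k => (-y) ^ k * s ^ (k ^ 2)) n n =
      qPoch (y * s) (s ^ 2) n * qPoch (y⁻¹ * s) (s ^ 2) n * qFactInv (s ^ 2) (2 * n) := by
  have hQ0 : s ^ 2 ≠ 0 := pow_ne_zero 2 hs0
  have hQ : ‖s ^ 2‖ < 1 := by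
    rw [norm_pow]
    exact pow_lt_one₀ (norm_nonneg s) hs two_ne_zero
  have hy' : -y ≠ 0 := neg_ne_zero.2 hy
  have zp : ∀ k : ℤ, (s ^ 2) ^ k = s ^ (2 * k) := fun k => by
    rw [zpow_mul]
    norm_cast
  induction n with
  | zero =>
    have h : ∀ k : ℤ, k ≠ 0 → (-y) ^ k * s ^ (k ^ 2) *
        (qFactInv (s ^ 2) (0 - 1 * k) * qFactInv (s ^ 2) (0 + 1 * k)) = 0 := by
      intro k hk
      rcases lt_or_gt_of_ne hk with h | h
      · rw [qFactInv_of_neg _ (j := 0 + 1 * k) (by lia), mul_zero, mul_zero]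
      · rw [qFactInv_of_neg _ (j := 0 - 1 * k) (by lia), zero_mul, mul_zero]
    simp only [Nat.cast_zero, binomSum]
    rw [tsum_eq_single 0 h]
    simp [qFactInv_zero, qPoch_zero]
  | succ n ih =>
    -- Passing from `(n, n)` to `(n, n + 1)` and then to `(n + 1, n + 1)`, the second Pascal term
    -- is, after a shift of `k`, a multiple of the first. The steps contribute the factors `1 -
    -- y⁻¹s·s^(2n)` and `1 - ys·s^(2n)`.
    have h1 := binomSum_pascal_left hQ0 hQ one_pos (fun k => (-y) ^ k * s ^ (k ^ 2)) (n + 1) (n + 1)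
    have h2 := binomSum_pascal_right hQ0 hQ one_pos (fun k => (-y) ^ k * s ^ (k ^ 2)) n (n + 1)
    have e1 : (fun k : ℤ => (-y) ^ (k + 1) * s ^ ((k + 1) ^ 2) * (s ^ 2) ^ (-(1 * (k + 1)))) =
        fun k => -y * s⁻¹ * ((-y) ^ k * s ^ (k ^ 2)) := by
      funext k
      rw [zp, zpow_add_one₀ hy', mul_assoc, ← zpow_add₀ hs0,
        show (k + 1) ^ 2 + 2 * -(1 * (k + 1)) = k ^ 2 + -1 by ring, zpow_add₀ hs0, zpow_neg_one]
      ring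
    have e2 : (fun k : ℤ => (-y) ^ k * s ^ (k ^ 2) * (s ^ 2) ^ (1 * k)) =
        fun k => -y⁻¹ * s⁻¹ * ((-y) ^ (k + 1) * s ^ ((k + 1) ^ 2)) := by
      funext k
      rw [zp, zpow_add_one₀ hy', mul_assoc, ← zpow_add₀ hs0,
        show (k + 1) ^ 2 = k ^ 2 + 2 * (1 * k) + 1 by ring, zpow_add_one₀ hs0]
      field_simp
    have h3 := binomSum_shift (s ^ 2) 1 (fun k => (-y) ^ k * s ^ (k ^ 2)) n n
    rw [binomSum_shift _ 1 (fun k => (-y) ^ k * s ^ (k ^ 2) * (s ^ 2) ^ (-(1 * k))), e1,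
      binomSum_const_mul, add_sub_cancel_right] at h1
    rw [e2, binomSum_const_mul, add_sub_cancel_right, ← h3, ih] at h2
    have p1 := one_sub_zpow_mul_qFactInv hQ (2 * (n + 1))
    have p2 := one_sub_zpow_mul_qFactInv hQ (2 * (n + 1) - 1)
    rw [show 2 * ((n : ℤ) + 1) - 1 - 1 = 2 * n by ring] at p2
    rw [show (n : ℤ) + 1 + (n + 1) = 2 * (n + 1) by ring] at h1
    rw [show (n : ℤ) + (n + 1) = 2 * (n + 1) - 1 by ring] at h2
    have n1 : (1 - (s ^ 2) ^ (2 * ((n : ℤ) + 1))) ≠ 0 := by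
      have := pow_succ_ne_one_of_norm_lt_one hQ (2 * n + 1)
      rw [← zpow_natCast] at this
      push_cast at this
      exact sub_ne_zero.2 fun h => this (by rw [h]; ring_nf)
    have n2 : (1 - (s ^ 2) ^ (2 * ((n : ℤ) + 1) - 1)) ≠ 0 := by
      have := pow_succ_ne_one_of_norm_lt_one hQ (2 * n)
      rw [← zpow_natCast] at this
      push_cast at this
      exact sub_ne_zero.2 fun h => this (by rw [h]; ring_nf)
    have z1 : (s ^ 2) ^ ((n : ℤ) + 1) = s * (s * (s ^ 2) ^ n) := by
      rw [zpow_add_one₀ hQ0, zpow_natCast]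
      ring
    push_cast
    refine mul_left_cancel₀ n1 (mul_left_cancel₀ n2 ?_)
    rw [h1, qPoch_succ, qPoch_succ, mul_left_comm _ (_ * _) (qFactInv _ _), p1,
      mul_left_comm _ (_ * _) (qFactInv _ _), p2]
    have a1 : s * (s * (s ^ 2) ^ n) * (-y * s⁻¹) = - (y * s * (s ^ 2) ^ n) := by
      field_simp
    have a2 : s * (s * (s ^ 2) ^ n) * (-y⁻¹ * s⁻¹) = - (y⁻¹ * s * (s ^ 2) ^ n) := by
      field_simp
    rw [z1, ← mul_assoc _ (-y * s⁻¹), a1]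
    rw [z1, ← mul_assoc _ (-y⁻¹ * s⁻¹), a2] at h2
    linear_combination (1 - y * s * (s ^ 2) ^ n) * h2

/-- The Jacobi triple product identity. -/
theorem hasSum_triple_product {y s : ℂ} (hy : y ≠ 0) (hs0 : s ≠ 0) (hs : ‖s‖ < 1) :
    HasSum (fun k : ℤ => (-y) ^ k * s ^ (k ^ 2))
      (qPochInf (y * s) (s ^ 2) * qPochInf (y⁻¹ * s) (s ^ 2) * qPochInf (s ^ 2) (s ^ 2)) := by
  have hQ : ‖s ^ 2‖ < 1 := by
    rw [norm_pow]
    exact pow_lt_one₀ (norm_nonneg s) hs two_ne_zero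
  have hsum := summable_zpow_mul_zpow_sq (neg_ne_zero.2 hy) hs0 hs
  have hne := qPochInf_self_ne_zero hQ
  obtain ⟨C, hC0, hC⟩ := exists_norm_qFactInv_le hQ
  have hcast : Tendsto (fun n : ℕ => (n : ℤ)) atTop atTop := tendsto_natCast_atTop_atTop
  have l1 : Tendsto (fun n : ℕ => binomSum (s ^ 2) 1 (fun k => (-y) ^ k * s ^ (k ^ 2)) n n) atTop
      (𝓝 (∑' k : ℤ, (-y) ^ k * s ^ (k ^ 2) *
        ((qPochInf (s ^ 2) (s ^ 2))⁻¹ * (qPochInf (s ^ 2) (s ^ 2))⁻¹))) := by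
    refine tendsto_tsum_of_dominated_convergence (hsum.norm.mul_right (C * C)) (fun k => ?_)
      (Eventually.of_forall fun n k => ?_)
    · refine Tendsto.const_mul _ (Tendsto.mul ?_ ?_)
      · exact (tendsto_qFactInv hQ).comp (tendsto_atTop_add_const_right _ _ hcast)
      · exact (tendsto_qFactInv hQ).comp (tendsto_atTop_add_const_right _ _ hcast)
    · rw [norm_mul, norm_mul (qFactInv _ _)]
      gcongr <;> exact hC _
  have l2 := ((tendsto_qPoch (y * s) hQ).mul (tendsto_qPoch (y⁻¹ * s) hQ)).mul
    ((tendsto_qFactInv hQ).comp (hcast.const_mul_atTop' (show (0 : ℤ) < 2 by norm_num)))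
  have l3 := tendsto_nhds_unique (l1.congr fun n => binomSum_triple_product hy hs0 hs n) l2
  rw [tsum_mul_right] at l3
  rw [hsum.hasSum_iff]
  field_simp at l3
  rw [div_eq_inv_mul] at l3
  linear_combination l3

/-! ### The limiting form of Bailey's lemma -/

theorem norm_sq_lt_one {q : ℂ} (hq : ‖q‖ < 1) : ‖q ^ 2‖ < 1 := by
  rw [norm_pow]
  exact pow_lt_one₀ (norm_nonneg q) hq two_ne_zero

/-- The summand `(-1)ⁿ (q; q²)_n q^{n²} / ((q²; q²)_{n-j} (q²; q²)_{n+j})`. -/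
noncomputable def baileyTerm (q : ℂ) (j : ℤ) (n : ℕ) : ℂ :=
  (-1) ^ n * qPoch q (q ^ 2) n * q ^ (n ^ 2) *
    (qFactInv (q ^ 2) (n - j) * qFactInv (q ^ 2) (n + j))

theorem exists_norm_bailey_coeff_le {q : ℂ} (hq : ‖q‖ < 1) :
    ∃ C, 0 ≤ C ∧ ∀ (n : ℕ) (a b : ℤ),
      ‖qPoch q (q ^ 2) n * (qFactInv (q ^ 2) a * qFactInv (q ^ 2) b)‖ ≤ C := by
  obtain ⟨C, hC0, hC⟩ := exists_norm_qPoch_le q (norm_sq_lt_one hq)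
  obtain ⟨D, hD0, hD⟩ := exists_norm_qFactInv_le (norm_sq_lt_one hq)
  refine ⟨C * (D * D), by positivity, fun n a b => ?_⟩
  rw [norm_mul, norm_mul]
  gcongr
  exacts [hC n, hD a, hD b]

theorem summable_norm_pow_sq {q : ℂ} (hq : ‖q‖ < 1) : Summable fun n : ℕ => ‖q‖ ^ (n ^ 2) :=
  (summable_geometric_of_lt_one (norm_nonneg q) hq).of_nonneg_of_le (fun _ => by positivity)
    fun n => pow_le_pow_of_le_one (norm_nonneg q) hq.le (Nat.le_self_pow two_ne_zero n)

theorem summable_baileyTerm {q : ℂ} (hq : ‖q‖ < 1) (j : ℤ) : Summable (baileyTerm q j) := by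
  obtain ⟨C, hC0, hC⟩ := exists_norm_bailey_coeff_le hq
  refine ((summable_norm_pow_sq hq).mul_left C).of_norm_bounded fun n => ?_
  have h : baileyTerm q j n = (-1) ^ n * (qPoch q (q ^ 2) n *
      (qFactInv (q ^ 2) (n - j) * qFactInv (q ^ 2) (n + j))) * q ^ (n ^ 2) := by
    unfold baileyTerm
    ring
  rw [h, norm_mul, norm_mul, norm_pow, norm_neg, norm_one, one_pow, one_mul, norm_pow]
  gcongr
  exact hC _ _ _

/-- The combination `baileyTerm q (j+1) n + q^(2j+1) * baileyTerm q j n` telescopes in `n` as `G n -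
G (n + 1)`, and `G 0 = 0` because its index `-j - 1` is negative. -/
theorem tsum_baileyTerm_succ {q : ℂ} (hq0 : q ≠ 0) (hq : ‖q‖ < 1) (j : ℕ) :
    ∑' n, baileyTerm q (j + 1) n = -q ^ (2 * j + 1) * ∑' n, baileyTerm q j n := by
  have hQ := norm_sq_lt_one hq
  have hQ0 : q ^ 2 ≠ 0 := pow_ne_zero 2 hq0
  obtain ⟨C, hC0, hC⟩ := exists_norm_bailey_coeff_le hq
  set G : ℕ → ℂ := fun n => (1 + q ^ (2 * j + 1)) * ((-1) ^ n * qPoch q (q ^ 2) n * q ^ (n ^ 2) *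
    (qFactInv (q ^ 2) (n - j - 1) * qFactInv (q ^ 2) (n + j))) with hG
  have sG : Summable G := by
    refine Summable.mul_left _ (((summable_norm_pow_sq hq).mul_left C).of_norm_bounded fun n => ?_)
    have h : (-1) ^ n * qPoch q (q ^ 2) n * q ^ (n ^ 2) *
        (qFactInv (q ^ 2) (n - j - 1) * qFactInv (q ^ 2) (n + j)) =
        (-1) ^ n * (qPoch q (q ^ 2) n *
        (qFactInv (q ^ 2) (n - j - 1) * qFactInv (q ^ 2) (n + j))) * q ^ (n ^ 2) := by
      ring
    rw [h, norm_mul, norm_mul, norm_pow, norm_neg, norm_one, one_pow, one_mul, norm_pow]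
    gcongr
    exact hC _ _ _
  have key : ∀ n, baileyTerm q (j + 1) n + q ^ (2 * j + 1) * baileyTerm q j n =
      G n - G (n + 1) := by
    intro n
    have p1 := one_sub_zpow_mul_qFactInv hQ (n - j)
    have p2 := one_sub_zpow_mul_qFactInv hQ (n + j + 1)
    rw [add_sub_cancel_right] at p2
    have z1 : (q ^ 2) ^ ((n : ℤ) - j) * (q ^ 2) ^ j = (q ^ 2) ^ n := by
      rw [← zpow_natCast (q ^ 2) j, ← zpow_natCast (q ^ 2) n, ← zpow_add₀ hQ0, sub_add_cancel]
    have z2 : (q ^ 2) ^ ((n : ℤ) + j + 1) = (q ^ 2) ^ n * (q ^ 2) ^ j * q ^ 2 := by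
      rw [zpow_add_one₀ hQ0, zpow_add₀ hQ0, zpow_natCast, zpow_natCast]
    have i1 : ((n + 1 : ℕ) : ℤ) - j - 1 = n - j := by push_cast; ring
    have i2 : ((n + 1 : ℕ) : ℤ) + j = n + j + 1 := by push_cast; ring
    simp only [hG, baileyTerm, i1, i2, qPoch_succ]
    rw [show (n : ℤ) - (j + 1) = n - j - 1 by ring, show (n : ℤ) + (j + 1) = n + j + 1 by ring,
      ← p1, ← p2, z2, ← z1]
    have z3 : q ^ ((n + 1) ^ 2) = q ^ (n ^ 2) * (q * ((q ^ 2) ^ ((n : ℤ) - j) * (q ^ 2) ^ j)) := by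
      rw [z1]
      ring
    rw [z3, show q ^ (2 * j + 1) = q * (q ^ 2) ^ j by ring, pow_succ (-1 : ℂ) n]
    generalize (q ^ 2) ^ ((n : ℤ) - j) = u
    generalize (q ^ 2) ^ j = v
    generalize qFactInv (q ^ 2) (n - j) = A
    generalize qFactInv (q ^ 2) (n + j + 1) = B
    ring
  have h1 : ∑' n, baileyTerm q (j + 1) n + q ^ (2 * j + 1) * ∑' n, baileyTerm q j n =
      ∑' n, G n - ∑' n, G (n + 1) := by
    rw [← tsum_mul_left, ← (summable_baileyTerm hq _).tsum_add ((summable_baileyTerm hq _).mul_left _),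
      ← sG.tsum_sub ((summable_nat_add_iff 1).2 sG)]
    exact tsum_congr key
  have h0 : G 0 = 0 := by
    simp only [hG]
    rw [qFactInv_of_neg _ (j := ((0 : ℕ) : ℤ) - j - 1) (by lia), zero_mul, mul_zero, mul_zero]
  rw [sG.tsum_eq_zero_add, h0] at h1
  linear_combination h1

theorem tsum_baileyTerm_natCast_eq {q : ℂ} (hq0 : q ≠ 0) (hq : ‖q‖ < 1) (j : ℕ) :
    ∑' n, baileyTerm q j n = (-1) ^ j * q ^ (j ^ 2) * ∑' n, baileyTerm q 0 n := by
  induction j with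
  | zero => simp
  | succ j ih =>
    have h := tsum_baileyTerm_succ hq0 hq j
    rw [ih] at h
    push_cast
    rw [h]
    ring

/-- The recursion makes the `j`-th sum divided by `(-1)^j q^(j²)` independent of `j`, so it can be
evaluated as `j → ∞`. After `n = m + j` the `m`-th term carries `q^(2mj)`, and only `m = 0`
survives. -/
theorem tsum_baileyTerm_zero {q : ℂ} (hq0 : q ≠ 0) (hq : ‖q‖ < 1) :
    ∑' n, baileyTerm q 0 n = qPochInf q (q ^ 2) / qPochInf (q ^ 2) (q ^ 2) := by
  have hQ := norm_sq_lt_one hq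
  obtain ⟨C, hC0, hC⟩ := exists_norm_bailey_coeff_le hq
  set f : ℕ → ℕ → ℂ := fun j m => (-1) ^ m * q ^ (m ^ 2) * q ^ (2 * m * j) *
    (qPoch q (q ^ 2) (m + j) * (qFactInv (q ^ 2) m * qFactInv (q ^ 2) (m + 2 * j))) with hf
  have h1 : ∀ j : ℕ, ∑' m, f j m = ∑' n, baileyTerm q 0 n := by
    intro j
    have hne : (-1 : ℂ) ^ j * q ^ (j ^ 2) ≠ 0 :=
      mul_ne_zero (pow_ne_zero _ (by norm_num)) (pow_ne_zero _ hq0)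
    refine mul_left_cancel₀ hne ?_
    rw [← tsum_baileyTerm_natCast_eq hq0 hq j,
      ← (summable_baileyTerm hq j).sum_add_tsum_nat_add j, ← tsum_mul_left,
      Finset.sum_eq_zero, zero_add]
    · refine tsum_congr fun m => ?_
      have i1 : ((m + j : ℕ) : ℤ) - j = m := by push_cast; ring
      have i2 : ((m + j : ℕ) : ℤ) + j = m + 2 * j := by push_cast; ring
      simp only [hf, baileyTerm, i1, i2]
      ring
    · intro n hn
      rw [baileyTerm, qFactInv_of_neg _ (j := (n : ℤ) - j), zero_mul, mul_zero]
      have := Finset.mem_range.1 hn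
      lia
  have hcast : Tendsto (fun n : ℕ => (n : ℤ)) atTop atTop := tendsto_natCast_atTop_atTop
  have h2 : Tendsto (fun j => ∑' m, f j m) atTop
      (𝓝 (∑' m : ℕ, if m = 0 then qPochInf q (q ^ 2) * (1 * (qPochInf (q ^ 2) (q ^ 2))⁻¹) else 0)) := by
    refine tendsto_tsum_of_dominated_convergence ((summable_norm_pow_sq hq).mul_right C)
      (fun m => ?_) (Eventually.of_forall fun j m => ?_)
    · have l1 : Tendsto (fun j : ℕ => qPoch q (q ^ 2) (m + j)) atTop (𝓝 (qPochInf q (q ^ 2))) :=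
        (tendsto_qPoch q hQ).comp (tendsto_atTop_mono (fun j => Nat.le_add_left j m) tendsto_id)
      have l2 : Tendsto (fun j : ℕ => qFactInv (q ^ 2) (m + 2 * j)) atTop
          (𝓝 (qPochInf (q ^ 2) (q ^ 2))⁻¹) :=
        (tendsto_qFactInv hQ).comp (tendsto_atTop_add_const_left _ _
          (hcast.const_mul_atTop' (show (0 : ℤ) < 2 by norm_num)))
      have l3 := l1.mul (l2.const_mul (qFactInv (q ^ 2) m))
      split_ifs with hm
      · subst hm
        simpa [hf, qFactInv_zero] using l3
      · have l4 : Tendsto (fun j : ℕ => q ^ (2 * m * j)) atTop (𝓝 0) := by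
          simp only [pow_mul q (2 * m)]
          refine tendsto_pow_atTop_nhds_zero_of_norm_lt_one ?_
          rw [norm_pow]
          exact pow_lt_one₀ (norm_nonneg q) hq (by lia)
        have l5 := (l4.const_mul ((-1) ^ m * q ^ (m ^ 2))).mul l3
        rwa [mul_zero, zero_mul] at l5
    · simp only [hf]
      rw [norm_mul, norm_mul, norm_mul, norm_pow, norm_neg, norm_one, one_pow, one_mul, norm_pow,
        norm_pow]
      refine mul_le_mul ?_ (hC _ _ _) (norm_nonneg _) (by positivity)
      exact mul_le_of_le_one_right (by positivity) (pow_le_one₀ (norm_nonneg q) hq.le)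
  rw [tsum_ite_eq] at h2
  simp only [h1] at h2
  rw [tendsto_nhds_unique tendsto_const_nhds h2, one_mul, div_eq_mul_inv]

theorem tsum_baileyTerm {q : ℂ} (hq0 : q ≠ 0) (hq : ‖q‖ < 1) (j : ℤ) :
    ∑' n, baileyTerm q j n =
      qPochInf q (q ^ 2) / qPochInf (q ^ 2) (q ^ 2) * ((-1) ^ j * q ^ (j ^ 2)) := by
  have hnat : ∀ j : ℕ, ∑' n, baileyTerm q j n =
      qPochInf q (q ^ 2) / qPochInf (q ^ 2) (q ^ 2) * ((-1) ^ (j : ℤ) * q ^ ((j : ℤ) ^ 2)) := by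
    intro j
    rw [tsum_baileyTerm_natCast_eq hq0 hq, tsum_baileyTerm_zero hq0 hq, mul_comm]
    norm_cast
  obtain ⟨m, rfl | rfl⟩ := j.eq_nat_or_neg
  · exact hnat m
  · have h : baileyTerm q (-m) = baileyTerm q m := by
      funext n
      rw [baileyTerm, baileyTerm, sub_neg_eq_add, ← sub_eq_add_neg, mul_comm (qFactInv _ _)]
    rw [h, hnat, neg_sq, zpow_neg, ← inv_zpow, inv_neg, inv_one]

theorem summable_pow_natAbs {r : ℝ} (h0 : 0 ≤ r) (h1 : r < 1) :
    Summable fun k : ℤ => r ^ k.natAbs := by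
  refine Summable.of_nat_of_neg ?_ ?_ <;> simpa using summable_geometric_of_lt_one h0 h1

/-- A limiting case of Bailey's lemma, for coefficients supported on a residue class modulo 3. -/
theorem hasSum_binomSum {q : ℂ} (hq0 : q ≠ 0) (hq : ‖q‖ < 1) {c : ℤ → ℂ} (hc : ∀ k, ‖c k‖ ≤ 1)
    {d : ℤ} (hd : ∀ k : ℤ, k.natAbs ≤ (3 * k + d).natAbs) :
    HasSum (fun n : ℕ => (-1) ^ n * qPoch q (q ^ 2) n * q ^ (n ^ 2) *
        binomSum (q ^ 2) 3 c (n - d) (n + d))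
      (qPochInf q (q ^ 2) / qPochInf (q ^ 2) (q ^ 2) *
        ∑' k : ℤ, c k * ((-1) ^ (3 * k + d) * q ^ ((3 * k + d) ^ 2))) := by
  obtain ⟨C, hC0, hC⟩ := exists_norm_bailey_coeff_le hq
  set F : ℕ × ℤ → ℂ := fun p => c p.2 * baileyTerm q (3 * p.2 + d) p.1 with hF
  set r := √‖q‖ with hr
  have hr0 : 0 ≤ r := Real.sqrt_nonneg _
  have hr1 : r < 1 := by
    rw [hr, Real.sqrt_lt' one_pos, one_pow]
    exact hq
  have hrq : ‖q‖ = r ^ 2 := (Real.sq_sqrt (norm_nonneg q)).symm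
  have sF : Summable F := by
    refine ((((summable_geometric_of_lt_one hr0 hr1).mul_of_nonneg (summable_pow_natAbs hr0 hr1)
      (fun _ => by positivity) (fun _ => by positivity))).mul_left C).of_norm_bounded fun p => ?_
    obtain ⟨n, k⟩ := p
    -- Nonzero terms have `|k| ≤ |3k + d| ≤ n`, so `|q|^(n²) = r^(2n²) ≤ r^(n + |k|)`: the square
    -- root leaves decay for both variables.
    rcases lt_or_ge n (3 * k + d).natAbs with h | h
    · have h0 : F (n, k) = 0 := by
        simp only [hF, baileyTerm]
        rcases le_total 0 (3 * k + d) with h' | h'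
        · rw [qFactInv_of_neg _ (j := (n : ℤ) - (3 * k + d)) (by lia)]
          ring
        · rw [qFactInv_of_neg _ (j := (n : ℤ) + (3 * k + d)) (by lia)]
          ring
      rw [h0, norm_zero]
      positivity
    · have h' : F (n, k) = c k * (-1) ^ n * (qPoch q (q ^ 2) n *
          (qFactInv (q ^ 2) (n - (3 * k + d)) * qFactInv (q ^ 2) (n + (3 * k + d)))) *
          q ^ (n ^ 2) := by
        simp only [hF, baileyTerm]
        ring
      rw [h', norm_mul, norm_mul, norm_mul, norm_pow, norm_neg, norm_one, one_pow, mul_one,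
        norm_pow, hrq, ← pow_mul, ← pow_add]
      have hle : r ^ (2 * n ^ 2) ≤ r ^ (n + k.natAbs) :=
        pow_le_pow_of_le_one hr0 hr1.le (by
          have := hd k
          nlinarith [Nat.le_self_pow two_ne_zero n])
      refine mul_le_mul ?_ hle (by positivity) hC0
      calc _ ≤ 1 * C := mul_le_mul (hc k) (hC _ _ _) (norm_nonneg _) zero_le_one
        _ = C := one_mul C
  have h1 : ∀ n : ℕ, HasSum (fun k => F (n, k)) ((-1) ^ n * qPoch q (q ^ 2) n * q ^ (n ^ 2) *
      binomSum (q ^ 2) 3 c (n - d) (n + d)) := by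
    intro n
    have h := ((summable_binomSum (q ^ 2) three_pos c (n - d) (n + d)).hasSum).mul_left
      ((-1) ^ n * qPoch q (q ^ 2) n * q ^ (n ^ 2))
    refine h.congr_fun fun k => ?_
    simp only [hF, baileyTerm]
    rw [show (n : ℤ) - d - 3 * k = n - (3 * k + d) by ring,
      show (n : ℤ) + d + 3 * k = n + (3 * k + d) by ring]
    ring
  have h2 : ∑' p, F p = qPochInf q (q ^ 2) / qPochInf (q ^ 2) (q ^ 2) *
      ∑' k : ℤ, c k * ((-1) ^ (3 * k + d) * q ^ ((3 * k + d) ^ 2)) := by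
    have sF' : Summable fun p => F (Equiv.prodComm ℤ ℕ p) :=
      (Equiv.prodComm ℤ ℕ).summable_iff.2 sF
    rw [← (Equiv.prodComm ℤ ℕ).tsum_eq F, sF'.tsum_prod, ← tsum_mul_left]
    refine tsum_congr fun k => ?_
    simp only [Equiv.prodComm_apply, Prod.swap_prod_mk, hF, tsum_mul_left, tsum_baileyTerm hq0 hq]
    ring
  rw [← h2]
  exact sF.hasSum.prod_fiberwise h1

/-! ### Theta functions of modulus 30 and the main theorem -/

theorem norm_zpow_le_one {q : ℂ} (hq : ‖q‖ ≤ 1) {m : ℤ} (hm : 0 ≤ m) : ‖q ^ m‖ ≤ 1 := by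
  lift m to ℕ using hm
  rw [zpow_natCast, norm_pow]
  exact pow_le_one₀ (norm_nonneg q) hq

/-- Triple product with `s = q^15` and `y = q^a`. -/
theorem tsum_theta {q : ℂ} (hq0 : q ≠ 0) (hq : ‖q‖ < 1) {a : ℤ} {u v : ℕ}
    (hu : (u : ℤ) = 15 - a) (hv : (v : ℤ) = 15 + a) :
    ∑' k : ℤ, (-1) ^ k * q ^ (15 * k ^ 2 + a * k) =
      qPochInf₃ (q ^ u) (q ^ v) (q ^ 30) (q ^ 30) := by
  have hs : ‖q ^ 15‖ < 1 := by
    rw [norm_pow]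
    exact pow_lt_one₀ (norm_nonneg q) hq (by norm_num)
  have h := (hasSum_triple_product (zpow_ne_zero a hq0) (pow_ne_zero 15 hq0) hs).tsum_eq
  have e1 : q ^ a * q ^ 15 = q ^ v := by
    rw [← zpow_natCast q v, hv, zpow_add₀ hq0, mul_comm]
    norm_cast
  have e2 : (q ^ a)⁻¹ * q ^ 15 = q ^ u := by
    rw [← zpow_natCast q u, hu, sub_eq_add_neg, zpow_add₀ hq0, zpow_neg, mul_comm]
    norm_cast
  rw [e1, e2, ← pow_mul] at h
  rw [qPochInf₃, mul_comm (qPochInf (q ^ u) _), ← h]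
  refine tsum_congr fun k => ?_
  rw [neg_eq_neg_one_mul (q ^ a), mul_zpow, ← zpow_mul, ← zpow_natCast q 15, ← zpow_mul, mul_assoc,
    ← zpow_add₀ hq0, add_comm]
  norm_cast

theorem neg_one_zpow_three_mul (k : ℤ) : (-1 : ℂ) ^ (3 * k) = (-1) ^ k := by
  rw [zpow_mul]
  norm_num

theorem sq_zpow (q : ℂ) (m : ℤ) : (q ^ 2) ^ m = q ^ (2 * m) := by
  rw [zpow_mul]
  norm_cast

/-- The classes `j = 3k` and `j = 3k + 1` give the theta exponents `15k² + 2k` and `15k² + 8k + 1`;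
the odd `j` shift turns the minus sign of the pair into a plus. -/
theorem hasSum_sq {q : ℂ} (hq0 : q ≠ 0) (hq : ‖q‖ < 1) :
    HasSum (fun n : ℕ => (-1) ^ n * qPoch q (q ^ 2) n * q ^ (n ^ 2) *
        ((q ^ 2) ^ (n ^ 2) * qFactInv (q ^ 2) (2 * n)))
      (qPochInf q (q ^ 2) / qPochInf (q ^ 2) (q ^ 2) *
        (qPochInf₃ (q ^ 13) (q ^ 17) (q ^ 30) (q ^ 30) +
          q * qPochInf₃ (q ^ 7) (q ^ 23) (q ^ 30) (q ^ 30))) := by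
  have hQ := norm_sq_lt_one hq
  have hc : ∀ k : ℤ, ‖(q ^ 2) ^ (3 * k ^ 2 + k)‖ ≤ 1 := fun k =>
    norm_zpow_le_one hQ.le (by
      rcases le_or_gt 0 k with h | h <;> nlinarith)
  have h0 := hasSum_binomSum hq0 hq hc (d := 0) (fun k => by lia)
  have h1 := hasSum_binomSum hq0 hq hc (d := 1) (fun k => by lia)
  have t0 : ∑' k : ℤ, (q ^ 2) ^ (3 * k ^ 2 + k) * ((-1) ^ (3 * k + 0) * q ^ ((3 * k + 0) ^ 2)) =
      qPochInf₃ (q ^ 13) (q ^ 17) (q ^ 30) (q ^ 30) := by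
    have h := tsum_theta hq0 hq (a := 2) (u := 13) (v := 17) (by norm_num) (by norm_num)
    rw [← h]
    refine tsum_congr fun k => ?_
    rw [add_zero, neg_one_zpow_three_mul, sq_zpow, mul_left_comm, ← zpow_add₀ hq0]
    ring_nf
  have t1 : ∑' k : ℤ, (q ^ 2) ^ (3 * k ^ 2 + k) * ((-1) ^ (3 * k + 1) * q ^ ((3 * k + 1) ^ 2)) =
      -(q * qPochInf₃ (q ^ 7) (q ^ 23) (q ^ 30) (q ^ 30)) := by
    have h := tsum_theta hq0 hq (a := 8) (u := 7) (v := 23) (by norm_num) (by norm_num)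
    rw [← h, ← tsum_mul_left, ← tsum_neg]
    refine tsum_congr fun k => ?_
    rw [zpow_add_one₀ (by norm_num), neg_one_zpow_three_mul, sq_zpow, mul_left_comm,
      ← zpow_add₀ hq0, mul_left_comm q, ← zpow_one_add₀ hq0]
    ring_nf
  rw [t0] at h0
  rw [t1] at h1
  have h := h0.sub h1
  convert h using 1
  · rfl
  · funext n
    rw [← bailey_pair_sq (pow_ne_zero 2 hq0) hQ, sub_zero, add_zero, mul_sub]
  · ring

theorem hasSum_sq_sub {q : ℂ} (hq0 : q ≠ 0) (hq : ‖q‖ < 1) :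
    HasSum (fun n : ℕ => (-1) ^ n * qPoch q (q ^ 2) n * q ^ (n ^ 2) *
        ((q ^ 2) ^ ((n : ℤ) ^ 2 - n) * qFactInv (q ^ 2) (2 * n)))
      (qPochInf q (q ^ 2) / qPochInf (q ^ 2) (q ^ 2) *
        (qPochInf₃ (q ^ 11) (q ^ 19) (q ^ 30) (q ^ 30) +
          q ^ 3 * qPochInf₃ q (q ^ 29) (q ^ 30) (q ^ 30))) := by
  have hQ := norm_sq_lt_one hq
  have hc : ∀ k : ℤ, ‖(q ^ 2) ^ (3 * k ^ 2 - 2 * k)‖ ≤ 1 := fun k =>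
    norm_zpow_le_one hQ.le (by
      rcases le_or_gt k 0 with h | h <;> nlinarith)
  have h0 := hasSum_binomSum hq0 hq hc (d := 0) (fun k => by lia)
  -- The pair has offset `d = -2`, whose exponent `15k² - 16k + 4` lies outside the range `|a| ≤ 15`
  -- of `tsum_theta`. Shifting `k` by one gives `d = 1` and `15k² + 14k + 3`.
  have h1 := hasSum_binomSum hq0 hq (fun k => hc (k + 1)) (d := 1) (fun k => by lia)
  have t0 : ∑' k : ℤ, (q ^ 2) ^ (3 * k ^ 2 - 2 * k) *
      ((-1) ^ (3 * k + 0) * q ^ ((3 * k + 0) ^ 2)) =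
      qPochInf₃ (q ^ 11) (q ^ 19) (q ^ 30) (q ^ 30) := by
    have h := tsum_theta hq0 hq (a := -4) (u := 19) (v := 11) (by norm_num) (by norm_num)
    rw [qPochInf₃, mul_comm (qPochInf (q ^ 11) _), ← qPochInf₃, ← h]
    refine tsum_congr fun k => ?_
    rw [add_zero, neg_one_zpow_three_mul, sq_zpow, mul_left_comm, ← zpow_add₀ hq0]
    ring_nf
  have t1 : ∑' k : ℤ, (q ^ 2) ^ (3 * (k + 1) ^ 2 - 2 * (k + 1)) *
      ((-1) ^ (3 * k + 1) * q ^ ((3 * k + 1) ^ 2)) =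
      -(q ^ 3 * qPochInf₃ q (q ^ 29) (q ^ 30) (q ^ 30)) := by
    have h := tsum_theta hq0 hq (a := 14) (u := 1) (v := 29) (by norm_num) (by norm_num)
    rw [pow_one] at h
    rw [← h, ← tsum_mul_left, ← tsum_neg]
    refine tsum_congr fun k => ?_
    rw [zpow_add_one₀ (by norm_num), neg_one_zpow_three_mul, sq_zpow, mul_left_comm,
      ← zpow_add₀ hq0, mul_left_comm (q ^ 3), ← zpow_natCast q 3, ← zpow_add₀ hq0]
    push_cast
    ring_nf
  rw [t0] at h0
  rw [t1] at h1
  have h := h0.sub h1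
  convert h using 1
  · rfl
  · funext n
    rw [← bailey_pair_sq_sub (pow_ne_zero 2 hq0) hQ, sub_zero, add_zero, mul_sub,
      binomSum_shift _ 3 _ ((n : ℤ) + 2), show (n : ℤ) + 2 - 3 = n - 1 by ring,
      show (n : ℤ) - 2 + 3 = n + 1 by ring]
  · ring

/-- Upper and lower signs correspond to `ε = 1` and `ε = -1`: `±` reads `ε`, `∓` reads `-ε`. -/
theorem mainTheorem3 (q : ℂ) (hq0 : 0 < ‖q‖) (hq1 : ‖q‖ < 1)
    (ε : ℂ) (hε : ε = 1 ∨ ε = -1) :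
    HasSum
      (fun n : ℕ =>
        (-ε) ^ n * (qPoch (ε * q) (q ^ 2) n / qPoch (q ^ 2) (q ^ 2) (2 * n)) *
          (q ^ (2 * n) - 1) * q ^ (3 * (n : ℤ) ^ 2 - 2 * (n : ℤ)))
      (qPochInf (ε * q) (q ^ 2) / qPochInf (q ^ 2) (q ^ 2) *
        (qPochInf₃ (ε * q ^ 13) (ε * q ^ 17) (q ^ 30) (q ^ 30)
          - qPochInf₃ (ε * q ^ 11) (ε * q ^ 19) (q ^ 30) (q ^ 30)
          + ε * q * qPochInf₃ (ε * q ^ 7) (ε * q ^ 23) (q ^ 30) (q ^ 30)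
          - ε * q ^ 3 * qPochInf₃ (ε * q) (ε * q ^ 29) (q ^ 30) (q ^ 30))) := by
  have hq : q ≠ 0 := norm_pos_iff.1 hq0
  have hε2 : ε ^ 2 = 1 := by rcases hε with rfl | rfl <;> norm_num
  have hεn : ‖ε‖ = 1 := by rcases hε with rfl | rfl <;> simp
  have hε0 : ε ≠ 0 := fun h => by simp [h] at hε2
  have heven : ∀ m : ℕ, Even m → (ε * q) ^ m = q ^ m := fun m hm => by
    rw [mul_pow]
    rcases hε with rfl | rfl
    · rw [one_pow, one_mul]
    · rw [hm.neg_one_pow, one_mul]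
  have hodd : ∀ m : ℕ, Odd m → (ε * q) ^ m = ε * q ^ m := fun m hm => by
    rw [mul_pow]
    rcases hε with rfl | rfl
    · rw [one_pow]
    · rw [hm.neg_one_pow]
  have hx0 : ε * q ≠ 0 := mul_ne_zero hε0 hq
  have hx1 : ‖ε * q‖ < 1 := by rwa [norm_mul, hεn, one_mul]
  -- Substituting `εq` leaves even powers of `q` unchanged and puts `ε` on odd ones; `n²` and `n`
  -- have equal parity, so `(εq)^(n²)` supplies the `ε^n`.
  have h := (hasSum_sq hx0 hx1).sub (hasSum_sq_sub hx0 hx1)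
  rw [heven 2 (by decide), heven 30 (by decide), hodd 3 (by decide), hodd 7 (by decide),
    hodd 11 (by decide), hodd 13 (by decide), hodd 17 (by decide), hodd 19 (by decide),
    hodd 23 (by decide), hodd 29 (by decide)] at h
  convert h using 1
  · rfl
  · funext n
    have p : qFactInv (q ^ 2) (2 * n) = (qPoch (q ^ 2) (q ^ 2) (2 * n))⁻¹ := by
      rw [← qFactInv_natCast, Nat.cast_mul, Nat.cast_ofNat]
    have z1 : (q ^ 2) ^ (n ^ 2) = (q ^ 2) ^ ((n : ℤ) ^ 2 - n) * q ^ (2 * n) := by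
      rw [pow_mul q 2 n, ← zpow_natCast (q ^ 2) n, ← zpow_add₀ (pow_ne_zero 2 hq), sub_add_cancel]
      norm_cast
    have z2 : q ^ (3 * (n : ℤ) ^ 2 - 2 * n) = q ^ (n ^ 2) * (q ^ 2) ^ ((n : ℤ) ^ 2 - n) := by
      rw [sq_zpow, ← zpow_natCast, ← zpow_add₀ hq]
      push_cast
      ring_nf
    have z3 : (ε * q) ^ (n ^ 2) = ε ^ n * q ^ (n ^ 2) := by
      rw [mul_pow]
      congr 1
      rcases hε with rfl | rfl
      · simp
      · rcases n.even_or_odd with hn | hn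
        · rw [hn.neg_one_pow, (hn.pow_of_ne_zero two_ne_zero).neg_one_pow]
        · rw [hn.neg_one_pow, hn.pow.neg_one_pow]
    rw [p, z1, z2, z3, neg_pow ε]
    ring
  · ring
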